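/- Let $d\in\mathbb N$ and let $F:\mathbb R^d\to\mathbb R$ be $\mathbb Z^d$-periodic and $C^3$, with set of minimizers exactly $\mathbb Z^d$, $F(0)=0$ and $D^2F(0)$ positive definite. Put $h(y,x)=\frac12|x-y|^2+F(y)$ and let $\psi$ be the normalized weak KAM solution, i.e. the continuous $\mathbb Z^d$-periodic function with $\psi(0)=0$ and $\psi(x)=\min_{y\in\mathbb R^d}\{\psi(y)+h(y,x)\}$ for all $x$. Let $\mathcal D^-(\psi)=\bigcup_{x}\operatorname{argmin}_y\{\psi(y)+h(y,x)\}$ and let $U\supset\mathcal D^-(\psi)$ be a $\mathbb Z^d$-periodic open set, fixed once $F$ is given. For $\nu>0$ put $$\widetilde K_\nu(y,x)=(4\pi\nu)^{-d/2}\,e^{\frac{1}{2\nu}\psi(x)}e^{-\frac1{2\nu}h(y,x)}e^{-\frac1{2\nu}\psi(y)},\qquad \widetilde{\mathcal L}_\nu u(x)=\int_{\mathbb R^d}\widetilde K_\nu(y,x)u(y)\,dy,$$ $$\pi^{(n)}_\nu(y,x)=\frac{\widetilde K_\nu(y,x)\,\widetilde{\mathcal L}_\nu^n\mathbf 1(y)}{\widetilde{\mathcal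 L}_\nu^{n+1}\mathbf 1(x)},\qquad \mathcal P^{(n)}_\nu u(x)=\int_{\mathbb R^d}\pi^{(n)}_\nu(y,x)u(y)\,dy\qquad(n\ge 0),$$ let $\chi_\nu=1$ on $U$ and $\chi_\nu=\nu^{-d/2}$ off $U$, $V=\psi\chi_\nu^2$, and for $\beta>0$ $$\|\varphi\|_{\beta V}=\sup_x\frac{|\varphi(x)|}{1+\beta V(x)},\qquad \|\varphi\|_{\beta V,*}=\inf_{c\in\mathbb R}\|\varphi+c\|_{\beta V}.$$ Then for every $D>1$ there exist $C>1$, $\alpha,\alpha_1\in(0,1)$ and $\nu_1>0$, depending only on $F$ (with the fixed $U$) and $D$, such that the following holds. Let $\nu_0>0$, $N(\nu)\in\mathbb N$ for $\nu\in(0,\nu_0)$, and $Q_n>0$ be such that for all $\nu\in(0,\nu_0)$, $0\le n\le N(\nu)$ and $x\in\mathbb R^d$, $$D^{-3}\le \frac{Q_n}{Q_{n+1}}\le D^3,\qquad D^{-1}\le\frac{\widetilde{\mathcal L}^n_\nu\mathbf 1(x)}{Q_n}\le D\,\chi_\nu(x).$$ Then for every $0<\nu<\min\{\nu_0,\nu_1\}$,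 every $0\le n\le N(\nu)$ and every bounded measurable $\mathbb Z^d$-periodic $u:\mathbb R^d\to\mathbb R$, $$\|\mathcal P^{(n)}_\nu u\|_{\beta V,*}\le\alpha\,\|u\|_{\beta V,*},\qquad \beta=\frac{\alpha_1}{C\nu}.$$ -/

import Mathlib

open MeasureTheory
open scoped ENNReal

noncomputable section

namespace KickedHJ

/-- The integer vector `k ∈ ℤ^d`, seen in `ℝ^d` with its Euclidean norm. -/
def intVec {d : ℕ} (k : Fin d → ℤ) : EuclideanSpace ℝ (Fin d) :=
  WithLp.toLp 2 (fun i => (k i : ℝ))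

/-- `ℤ^d`-periodicity of a function on `ℝ^d`. -/
def IsPeriodic {d : ℕ} {β : Type*} (f : EuclideanSpace ℝ (Fin d) → β) : Prop :=
  ∀ (k : Fin d → ℤ) (x : EuclideanSpace ℝ (Fin d)), f (x + intVec k) = f x

/-- `ℤ^d`-periodicity of a subset of `ℝ^d`, i.e. it is the lift of a subset of the torus. -/
def IsPeriodicSet {d : ℕ} (U : Set (EuclideanSpace ℝ (Fin d))) : Prop :=
  ∀ (k : Fin d → ℤ) (x : EuclideanSpace ℝ (Fin d)), x + intVec k ∈ U ↔ x ∈ U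

/-- The standing assumption on the kick potential: `F` is `C^3` and `ℤ^d`-periodic, its set of
minimizers on the torus is `{0}`, `F 0 = 0`, and the Hessian of `F` at `0` is positive definite. -/
structure IsKickPotential {d : ℕ} (F : EuclideanSpace ℝ (Fin d) → ℝ) : Prop where
  contDiff : ContDiff ℝ 3 F
  periodic : IsPeriodic F
  argmin : {x | ∀ y, F x ≤ F y} = Set.range (intVec (d := d))
  map_zero : F 0 = 0
  hessian_pos : ∀ v : EuclideanSpace ℝ (Fin d), v ≠ 0 → 0 < fderiv ℝ (fderiv ℝ F) 0 v v

/-- The generating function `h(y, x) = |x - y|^2 / 2 + F(y)`. -/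
def genFun {d : ℕ} (F : EuclideanSpace ℝ (Fin d) → ℝ) (y x : EuclideanSpace ℝ (Fin d)) : ℝ :=
  (1 / 2) * ‖x - y‖ ^ 2 + F y

/-- `ψ` is the normalized weak KAM solution: a continuous periodic fixed point of the Lax-Oleinik
operator, `ψ(x) = min_y (ψ(y) + h(y, x))`, with `ψ(0) = 0`. -/
structure IsWeakKAM {d : ℕ} (F ψ : EuclideanSpace ℝ (Fin d) → ℝ) : Prop where
  continuous : Continuous ψ
  periodic : IsPeriodic ψ
  map_zero : ψ 0 = 0
  fixed : ∀ x, IsLeast (Set.range fun y => ψ y + genFun F y x) (ψ x)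

/-- The set `𝒟⁻(ψ) = ⋃ₓ argmin_y (ψ(y) + h(y, x))`. -/
def dMinus {d : ℕ} (F ψ : EuclideanSpace ℝ (Fin d) → ℝ) : Set (EuclideanSpace ℝ (Fin d)) :=
  {y | ∃ x, ∀ z, ψ y + genFun F y x ≤ ψ z + genFun F z x}

/-- The kernel `K_ν(y, x) = (4πν)^{-d/2} exp(-h(y, x) / (2ν))`. -/
def heatKernel {d : ℕ} (F : EuclideanSpace ℝ (Fin d) → ℝ) (ν : ℝ)
    (y x : EuclideanSpace ℝ (Fin d)) : ℝ :=
  (4 * Real.pi * ν) ^ (-(d : ℝ) / 2) * Real.exp (-(1 / (2 * ν)) * genFun F y x)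

/-- The conjugate kernel `e^{ψ(x)/(2ν)} K_ν(y, x) e^{-ψ(y)/(2ν)}`. -/
def conjKernel {d : ℕ} (F ψ : EuclideanSpace ℝ (Fin d) → ℝ) (ν : ℝ)
    (y x : EuclideanSpace ℝ (Fin d)) : ℝ :=
  Real.exp (ψ x / (2 * ν)) * heatKernel F ν y x * Real.exp (-ψ y / (2 * ν))

/-- The conjugate operator `u ↦ ∫ K̃_ν(y, ·) u(y) dy`. -/
def conjOp {d : ℕ} (F ψ : EuclideanSpace ℝ (Fin d) → ℝ) (ν : ℝ)
    (u : EuclideanSpace ℝ (Fin d) → ℝ) (x : EuclideanSpace ℝ (Fin d)) : ℝ :=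
  ∫ y, conjKernel F ψ ν y x * u y

/-- The `n`-th partition function, the `n`-th iterate of the conjugate operator at the constant
function `1`. -/
def partitionFun {d : ℕ} (F ψ : EuclideanSpace ℝ (Fin d) → ℝ) (ν : ℝ) (n : ℕ) :
    EuclideanSpace ℝ (Fin d) → ℝ :=
  (conjOp F ψ ν)^[n] (fun _ => 1)

/-- The Markov kernel `π_ν^{(n)}(y, x) = K̃_ν(y, x) (L̃_ν^n 1)(y) / (L̃_ν^{n+1} 1)(x)`. -/
def markovKernel {d : ℕ} (F ψ : EuclideanSpace ℝ (Fin d) → ℝ) (ν : ℝ) (n : ℕ)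
    (y x : EuclideanSpace ℝ (Fin d)) : ℝ :=
  conjKernel F ψ ν y x * partitionFun F ψ ν n y / partitionFun F ψ ν (n + 1) x

/-- The Markov operator `P_ν^{(n)} u (x) = ∫ π_ν^{(n)}(y, x) u(y) dy`. -/
def markovOp {d : ℕ} (F ψ : EuclideanSpace ℝ (Fin d) → ℝ) (ν : ℝ) (n : ℕ)
    (u : EuclideanSpace ℝ (Fin d) → ℝ) (x : EuclideanSpace ℝ (Fin d)) : ℝ :=
  ∫ y, markovKernel F ψ ν n y x * u y

open Classical in
/-- The function `χ_ν`, equal to `1` on `U` and to `ν^{-d/2}` off `U`. -/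
def chi {d : ℕ} (U : Set (EuclideanSpace ℝ (Fin d))) (ν : ℝ)
    (x : EuclideanSpace ℝ (Fin d)) : ℝ :=
  if x ∈ U then 1 else ν ^ (-(d : ℝ) / 2)

/-- The Lyapunov function `V = ψ χ_ν^2`. -/
def lyapunov {d : ℕ} (ψ : EuclideanSpace ℝ (Fin d) → ℝ) (U : Set (EuclideanSpace ℝ (Fin d)))
    (ν : ℝ) (x : EuclideanSpace ℝ (Fin d)) : ℝ :=
  ψ x * chi U ν x ^ 2

/-- The weighted norm `sup_x |φ(x)| / (1 + β V(x))`, with values in `[0, ∞]`. -/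
def weightedNorm {X : Type*} (β : ℝ) (V φ : X → ℝ) : ℝ≥0∞ :=
  ⨆ x, ENNReal.ofReal (|φ x| / (1 + β * V x))

/-- The weighted norm modulo constants, `inf_{c ∈ ℝ} ‖φ + c‖_{βV}`. -/
def weightedOsc {X : Type*} (β : ℝ) (V φ : X → ℝ) : ℝ≥0∞ :=
  ⨅ c : ℝ, weightedNorm β V (fun x => φ x + c)

end KickedHJ

end

/-! ### Harris' theorem for weighted oscillation seminorms. -/

namespace KickedHJ

/-! The contraction is Harris' theorem (`weightedOsc_integral_le`): a drift bound for `V` together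
with a minorization on a sublevel set of `V`, both uniform once `V` is measured in units of `ν`.

Everything is read off the `defect` `ψ(y) + h(y, x) - ψ(x) ≥ 0`, since the conjugate kernel is
`(4πν)^(-d/2) exp(-defect / (2ν))`. The bounds on the partition functions, together with a Gaussian
lower bound for the normalizer, control the Markov kernel by this kernel times `χ`.

Drift (`integral_mul_lyapunov_le`): `F` and `ψ` are both comparable to the squared distance to the
lattice, so `κ ψ ≤ F`. A transition to `y` with `ψ(y)` not smaller than `ψ(x)` by a fixed factor
therefore costs a defect of order `ψ(y)`, and contributes `O(ν)`. Off `U` the defect is bounded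
below, and `exp(-δ / (2ν))` absorbs the powers of `ν` hidden in `χ`.

Minorization (`le_conjKernel_of_mem_ball`): if `V(x) ≤ Rν`, then `x` is within `O(√ν)` of a lattice
point, and the kernel is of order `ν^(-d/2)` on the ball of radius `√ν` there. Different `x` may
give different balls, but these are lattice translates, which a periodic `u` does not distinguish.
-/

theorem exists_abs_add_const_le {X : Type*} [Nonempty X] {f w : X → ℝ}
    (h : ∀ x y, f x - f y ≤ w x + w y) : ∃ c : ℝ, ∀ x, |f x + c| ≤ w x := by
  have hb : BddAbove (Set.range fun x => f x - w x) := by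
    obtain ⟨y⟩ := ‹Nonempty X›
    refine ⟨f y + w y, ?_⟩
    rintro _ ⟨x, rfl⟩
    have := h x y
    simp only
    linarith
  -- Any constant between `sup (f - w)` and `inf (f + w)` recenters `f`; the hypothesis says that
  -- these do not cross.
  refine ⟨-(⨆ x, (f x - w x)), fun x => abs_le.2 ⟨?_, ?_⟩⟩
  · have : (⨆ x, (f x - w x)) ≤ f x + w x := ciSup_le fun y => by linarith [h y x]
    linarith
  · have := le_ciSup hb x
    linarith

/-- Turns the seminorm bound into a two-point estimate: a function is within a weight of some
constant as soon as its differences are at most the sum of the two weights. -/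
theorem weightedOsc_le_mul {X : Type*} [Nonempty X] {β α : ℝ} {V u v : X → ℝ}
    (hα : 0 < α) (hV : ∀ x, 0 < 1 + β * V x)
    (h : ∀ c s : ℝ, 0 ≤ s → (∀ x, |u x + c| ≤ s * (1 + β * V x)) →
      ∀ x y, v x - v y ≤ α * s * (1 + β * V x) + α * s * (1 + β * V y)) :
    weightedOsc β V v ≤ ENNReal.ofReal α * weightedOsc β V u := by
  unfold weightedOsc
  rw [ENNReal.mul_iInf_of_ne (by simpa using hα) ENNReal.ofReal_ne_top]
  refine le_iInf fun c => ?_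
  rcases eq_or_ne (weightedNorm β V fun x => u x + c) ⊤ with htop | htop
  · rw [htop, ENNReal.mul_top (by simpa using hα)]
    exact le_top
  set s := (weightedNorm β V fun x => u x + c).toReal with hs
  have hus : ∀ x, |u x + c| ≤ s * (1 + β * V x) := fun x => by
    rw [← div_le_iff₀ (hV x), hs, ← ENNReal.ofReal_le_iff_le_toReal htop]
    exact le_iSup (fun x => ENNReal.ofReal (|u x + c| / (1 + β * V x))) x
  obtain ⟨c', hc'⟩ := exists_abs_add_const_le (h c s ENNReal.toReal_nonneg hus)
  refine (iInf_le _ c').trans (iSup_le fun x => ?_)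
  rw [← ENNReal.ofReal_toReal htop, ← hs, ← ENNReal.ofReal_mul hα.le]
  exact ENNReal.ofReal_le_ofReal ((div_le_iff₀ (hV x)).2 (hc' x))

/-- Only `p - q ≥ 0` is integrated against the weight `1 + βV`; the term in `q * V` has a favourable
sign and is dropped. -/
theorem integral_mul_le_of_minorant {X : Type*} [MeasurableSpace X] {μ : Measure X}
    {p q V g : X → ℝ} {s β : ℝ} (hs : 0 ≤ s) (hβ : 0 ≤ β) (hV : ∀ y, 0 ≤ V y)
    (hq0 : ∀ y, 0 ≤ q y) (hqp : ∀ y, q y ≤ p y) (hp : Integrable p μ) (hq : Integrable q μ)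
    (hpV : Integrable (fun y => p y * V y) μ) (hpg : Integrable (fun y => p y * g y) μ)
    (hqg : Integrable (fun y => q y * g y) μ) (hg : ∀ y, g y ≤ s * (1 + β * V y)) :
    ∫ y, p y * g y ∂μ ≤
      ∫ y, q y * g y ∂μ + s * (∫ y, p y ∂μ - ∫ y, q y ∂μ + β * ∫ y, p y * V y ∂μ) := by
  have hpq : Integrable (fun y => s * (p y - q y)) μ := (hp.sub hq).const_mul s
  have h : ∫ y, (p y * g y - q y * g y) ∂μ ≤
      ∫ y, (s * (p y - q y) + s * β * (p y * V y)) ∂μ := by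
    refine integral_mono (hpg.sub hqg) (hpq.add (hpV.const_mul _)) fun y => ?_
    have h1 := mul_le_mul_of_nonneg_left (hg y) (sub_nonneg.2 (hqp y))
    have h2 : 0 ≤ s * β * (q y * V y) :=
      mul_nonneg (mul_nonneg hs hβ) (mul_nonneg (hq0 y) (hV y))
    simp only
    nlinarith
  rw [integral_sub hpg hqg, integral_add hpq (hpV.const_mul _),
    integral_const_mul, integral_const_mul, integral_sub hp hq] at h
  linarith

/-- Harris' theorem in the form of Hairer and Mattingly, for one step of a Markov kernel with
density `p · x`, where the minorization is only required to be seen by the test function `u`. -/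
theorem weightedOsc_integral_le {X : Type*} [MeasurableSpace X] [Nonempty X] {μ : Measure X}
    {p q : X → X → ℝ} {V u : X → ℝ} {γ K R a I β α : ℝ}
    (hβ : 0 ≤ β) (hα : 0 < α) (hV : ∀ x, 0 ≤ V x) (hp0 : ∀ x y, 0 ≤ p y x)
    (hp : ∀ x, Integrable (fun y => p y x) μ) (hp1 : ∀ x, ∫ y, p y x ∂μ = 1)
    (hpV : ∀ x, Integrable (fun y => p y x * V y) μ)
    (hpu : ∀ x, Integrable (fun y => p y x * u y) μ)
    (hdrift : ∀ x, ∫ y, p y x * V y ∂μ ≤ γ * V x + K)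
    (hq0 : ∀ x, V x ≤ R → ∀ y, 0 ≤ q y x) (hqp : ∀ x, V x ≤ R → ∀ y, q y x ≤ p y x)
    (hq : ∀ x, V x ≤ R → Integrable (fun y => q y x) μ)
    (hqu : ∀ x, V x ≤ R → Integrable (fun y => q y x * u y) μ)
    (hq1 : ∀ x, V x ≤ R → ∫ y, q y x ∂μ = a)
    (hqI : ∀ x, V x ≤ R → ∫ y, q y x * u y ∂μ = I)
    (hγα : γ ≤ α) (haα : 1 - a + β * K ≤ α)
    (hRα : 2 + 2 * (β * K) + γ * (β * R) ≤ α * (2 + β * R)) :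
    weightedOsc β V (fun x => ∫ y, p y x * u y ∂μ) ≤ ENNReal.ofReal α * weightedOsc β V u := by
  refine weightedOsc_le_mul hα (fun x => by have := mul_nonneg hβ (hV x); linarith) ?_
  intro c s hs hu x x'
  have hpg : ∀ x, Integrable (fun y => p y x * (u y + c)) μ := fun x => by
    simp only [mul_add]
    exact (hpu x).add ((hp x).mul_const c)
  have hpgI : ∀ x, ∫ y, p y x * (u y + c) ∂μ = ∫ y, p y x * u y ∂μ + c := fun x => by
    simp only [mul_add]
    rw [integral_add (hpu x) ((hp x).mul_const c), integral_mul_const, hp1, one_mul]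
  have hqg : ∀ x, V x ≤ R → Integrable (fun y => q y x * (u y + c)) μ := fun x hx => by
    simp only [mul_add]
    exact (hqu x hx).add ((hq x hx).mul_const c)
  have hqgI : ∀ x, V x ≤ R → ∫ y, q y x * (u y + c) ∂μ = I + a * c := fun x hx => by
    simp only [mul_add]
    rw [integral_add (hqu x hx) ((hq x hx).mul_const c), integral_mul_const, hq1 x hx, hqI x hx]
  have hb : ∀ x, s * β * ∫ y, p y x * V y ∂μ ≤ s * β * (γ * V x + K) := fun x =>
    mul_le_mul_of_nonneg_left (hdrift x) (mul_nonneg hs hβ)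
  -- If both points lie low, the two minorants have equal mass and equal integral against `u`, so
  -- they cancel and gain `a`. Otherwise the minorant `0` is used and the drift alone gives the
  -- contraction.
  by_cases hR : V x + V x' ≤ R
  · have hx : V x ≤ R := by linarith [hV x']
    have hx' : V x' ≤ R := by linarith [hV x]
    have h1 := integral_mul_le_of_minorant hs hβ hV (hq0 x hx) (hqp x hx) (hp x) (hq x hx) (hpV x)
      (hpg x) (hqg x hx) (fun y => (abs_le.1 (hu y)).2)
    have h2 := integral_mul_le_of_minorant (g := fun y => -(u y + c)) hs hβ hV (hq0 x' hx')
      (hqp x' hx') (hp x') (hq x' hx') (hpV x')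
      (by simp only [mul_neg]; exact (hpg x').neg) (by simp only [mul_neg]; exact (hqg x' hx').neg)
      (fun y => by linarith [(abs_le.1 (hu y)).1])
    simp only [mul_neg, integral_neg] at h2
    rw [hpgI, hqgI x hx, hp1, hq1 x hx] at h1
    rw [hpgI, hqgI x' hx', hp1, hq1 x' hx'] at h2
    have h3 := mul_le_mul_of_nonneg_left hγα
      (mul_nonneg (mul_nonneg hs hβ) (add_nonneg (hV x) (hV x')))
    have h4 := mul_le_mul_of_nonneg_left haα hs
    nlinarith [hb x, hb x']
  · push Not at hR
    have h1 := integral_mul_le_of_minorant (q := fun _ => 0) hs hβ hV (fun _ => le_rfl) (hp0 x)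
      (hp x) (by simp) (hpV x) (hpg x) (by simp) (fun y => (abs_le.1 (hu y)).2)
    have h2 := integral_mul_le_of_minorant (q := fun _ => 0) (g := fun y => -(u y + c)) hs hβ hV
      (fun _ => le_rfl) (hp0 x') (hp x') (by simp) (hpV x')
      (by simp only [mul_neg]; exact (hpg x').neg) (by simp)
      (fun y => by linarith [(abs_le.1 (hu y)).1])
    simp only [mul_neg, integral_neg, zero_mul, integral_zero, hpgI, hp1, neg_zero] at h1 h2
    have h3 : 0 ≤ s * ((α - γ) * (β * (V x + V x' - R))) := by
      refine mul_nonneg hs (mul_nonneg (sub_nonneg.2 hγα) (mul_nonneg hβ ?_))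
      linarith
    have h4 := mul_le_mul_of_nonneg_left hRα hs
    nlinarith [hb x, hb x']

/-! ### Periodicity under the integer lattice. -/

section Lattice

variable {d : ℕ}

theorem intVec_zero : intVec (0 : Fin d → ℤ) = 0 := by
  ext i; simp [intVec]

theorem intVec_neg (k : Fin d → ℤ) : intVec (-k) = -intVec k := by
  ext i; simp [intVec]

theorem IsPeriodic.sub {β : Type*} {f : EuclideanSpace ℝ (Fin d) → β} (hf : IsPeriodic f)
    (k : Fin d → ℤ) (x : EuclideanSpace ℝ (Fin d)) : f (x - intVec k) = f x := by
  rw [sub_eq_add_neg, ← intVec_neg, hf]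

theorem IsPeriodic.map_intVec {β : Type*} {f : EuclideanSpace ℝ (Fin d) → β} (hf : IsPeriodic f)
    (k : Fin d → ℤ) : f (intVec k) = f 0 := by
  rw [← hf k 0, zero_add]

theorem exists_norm_sub_intVec_le (y : EuclideanSpace ℝ (Fin d)) :
    ∃ k : Fin d → ℤ, ‖y - intVec k‖ ≤ Real.sqrt d := by
  refine ⟨fun i => ⌊y i⌋, ?_⟩
  rw [EuclideanSpace.norm_eq]
  refine Real.sqrt_le_sqrt ?_
  calc ∑ i, ‖(y - intVec fun i => ⌊y i⌋) i‖ ^ 2 ≤ ∑ _i : Fin d, (1 : ℝ) := by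
        refine Finset.sum_le_sum fun i _ => ?_
        have h1 := Int.fract_nonneg (y i)
        have h2 := (Int.fract_lt_one (y i)).le
        have h3 : (y - intVec fun i => ⌊y i⌋) i = Int.fract (y i) := by
          simp [intVec]
        rw [h3, Real.norm_of_nonneg h1]
        exact pow_le_one₀ h1 h2
    _ = d := by simp

theorem IsPeriodic.exists_norm_le {E : Type*} [NormedAddCommGroup E]
    {f : EuclideanSpace ℝ (Fin d) → E} (hf : IsPeriodic f) (hc : Continuous f) :
    ∃ M : ℝ, 0 < M ∧ ∀ x, ‖f x‖ ≤ M := by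
  obtain ⟨M, hM⟩ := (isCompact_closedBall (0 : EuclideanSpace ℝ (Fin d))
    (Real.sqrt d)).exists_bound_of_continuousOn hc.continuousOn
  refine ⟨max M 1, by positivity, fun x => ?_⟩
  obtain ⟨k, hk⟩ := exists_norm_sub_intVec_le x
  rw [← hf.sub k]
  exact (hM _ (by simpa using hk)).trans (le_max_left _ _)

theorem IsPeriodic.fderiv {E : Type*} [NormedAddCommGroup E] [NormedSpace ℝ E]
    {f : EuclideanSpace ℝ (Fin d) → E} (hf : IsPeriodic f) : IsPeriodic (fderiv ℝ f) := by
  intro k x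
  rw [← fderiv_comp_add_right]
  congr 1
  exact funext (hf k)

end Lattice

/-! ### Quadratic bounds on the potential. -/

namespace IsKickPotential

variable {d : ℕ} {F : EuclideanSpace ℝ (Fin d) → ℝ}

theorem nonneg (hF : IsKickPotential F) (y : EuclideanSpace ℝ (Fin d)) : 0 ≤ F y := by
  have h : (0 : EuclideanSpace ℝ (Fin d)) ∈ {x | ∀ y, F x ≤ F y} := by
    rw [hF.argmin]; exact ⟨0, intVec_zero⟩
  simpa [hF.map_zero] using h y

theorem map_intVec (hF : IsKickPotential F) (k : Fin d → ℤ) : F (intVec k) = 0 := by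
  rw [hF.periodic.map_intVec, hF.map_zero]

theorem exists_eq_intVec (hF : IsKickPotential F) {y : EuclideanSpace ℝ (Fin d)} (hy : F y ≤ 0) :
    ∃ k, intVec k = y := by
  have h : y ∈ {x | ∀ y, F x ≤ F y} := fun z => hy.trans (hF.nonneg z)
  rwa [hF.argmin] at h

theorem continuous (hF : IsKickPotential F) : Continuous F := hF.contDiff.continuous

theorem differentiable (hF : IsKickPotential F) : Differentiable ℝ F :=
  hF.contDiff.differentiable (by norm_num)

theorem contDiff_fderiv (hF : IsKickPotential F) : ContDiff ℝ 1 (fderiv ℝ F) :=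
  (hF.contDiff.of_le (by norm_num : (2 : WithTop ℕ∞) ≤ 3)).fderiv_right (by norm_num)

/-- The second derivative is continuous and periodic, hence bounded; the mean value inequality is
applied to `DF`, then to `w ↦ F (w + v) - F w`. -/
theorem exists_second_difference_le (hF : IsKickPotential F) :
    ∃ M : ℝ, 0 < M ∧ ∀ y v, F (y + v) + F (y - v) - 2 * F y ≤ M * ‖v‖ ^ 2 := by
  have hd := hF.contDiff_fderiv.differentiable (by norm_num)
  obtain ⟨M, hM0, hM⟩ := hF.periodic.fderiv.fderiv.exists_norm_le
    (hF.contDiff_fderiv.continuous_fderiv (by norm_num))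
  refine ⟨M, hM0, fun y v => ?_⟩
  have hL : ∀ w, ‖fderiv ℝ F (w + v) - fderiv ℝ F w‖ ≤ M * ‖v‖ := fun w => by
    simpa using convex_univ.norm_image_sub_le_of_norm_fderiv_le (𝕜 := ℝ) (f := fderiv ℝ F)
      (fun x _ => hd x) (fun x _ => hM x) (Set.mem_univ w) (Set.mem_univ (w + v))
  have hg : ∀ w, HasFDerivAt (fun w => F (w + v) - F w)
      (fderiv ℝ F (w + v) - fderiv ℝ F w) w := fun w =>
    ((hasFDerivAt_comp_add_right v).2 (hF.differentiable (w + v)).hasFDerivAt).sub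
      (hF.differentiable w).hasFDerivAt
  have h := convex_univ.norm_image_sub_le_of_norm_hasFDerivWithin_le
    (fun x _ => (hg x).hasFDerivWithinAt) (fun x _ => hL x) (Set.mem_univ (y - v)) (Set.mem_univ y)
  simp only [sub_add_cancel, sub_sub_cancel, Real.norm_eq_abs] at h
  nlinarith [(abs_le.1 h).2]

theorem le_mul_norm_sub_sq (hF : IsKickPotential F) {M : ℝ}
    (hM : ∀ y v, F (y + v) + F (y - v) - 2 * F y ≤ M * ‖v‖ ^ 2) (k : Fin d → ℤ)
    (y : EuclideanSpace ℝ (Fin d)) : F y ≤ M * ‖y - intVec k‖ ^ 2 := by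
  have h := hM (intVec k) (y - intVec k)
  rw [hF.map_intVec, add_sub_cancel] at h
  linarith [hF.nonneg (intVec k - (y - intVec k))]

theorem exists_hessian_ge (hF : IsKickPotential F) :
    ∃ c : ℝ, 0 < c ∧ ∀ v, c * ‖v‖ ^ 2 ≤ fderiv ℝ (fderiv ℝ F) 0 v v := by
  -- The minimum over the unit sphere serves as the constant; the sphere is empty when `d = 0`.
  have hcont : Continuous fun v => fderiv ℝ (fderiv ℝ F) 0 v v :=
    (fderiv ℝ (fderiv ℝ F) 0).continuous.clm_apply continuous_id
  rcases (Metric.sphere (0 : EuclideanSpace ℝ (Fin d)) 1).eq_empty_or_nonempty with he | hne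
  · refine ⟨1, one_pos, fun v => ?_⟩
    rcases eq_or_ne v 0 with rfl | hv
    · simp
    · have : ‖v‖⁻¹ • v ∈ Metric.sphere (0 : EuclideanSpace ℝ (Fin d)) 1 := by
        simp [norm_smul, hv]
      simp [he] at this
  · obtain ⟨w, hw, hmin⟩ := (isCompact_sphere _ _).exists_isMinOn hne hcont.continuousOn
    have hw0 : w ≠ 0 := by rintro rfl; simp at hw
    refine ⟨_, hF.hessian_pos w hw0, fun v => ?_⟩
    rcases eq_or_ne v 0 with rfl | hv
    · simp
    · have hv' : ‖v‖⁻¹ • v ∈ Metric.sphere (0 : EuclideanSpace ℝ (Fin d)) 1 := by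
        simp [norm_smul, hv]
      have h := hmin hv'
      simp only [Set.mem_ofPred_eq, map_smul, smul_apply, smul_eq_mul] at h
      have hn : 0 < ‖v‖ := norm_pos_iff.2 hv
      calc _ ≤ (‖v‖⁻¹ * (‖v‖⁻¹ * fderiv ℝ (fderiv ℝ F) 0 v v)) * ‖v‖ ^ 2 := by gcongr
        _ = _ := by field_simp

/-- Differentiability of `DF` at the critical point `0` gives `DF(z) z ≥ (c/2)|z|²` nearby, which is
then integrated along rays by a monotonicity argument. -/
theorem exists_local_quadratic_le (hF : IsKickPotential F) :
    ∃ c ρ : ℝ, 0 < c ∧ 0 < ρ ∧ ∀ v, ‖v‖ < ρ → c * ‖v‖ ^ 2 ≤ F v := by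
  obtain ⟨c, hc, hH⟩ := hF.exists_hessian_ge
  have hd0 : fderiv ℝ F 0 = 0 :=
    IsLocalMin.fderiv_eq_zero (Filter.Eventually.of_forall fun y => by
      rw [hF.map_zero]; exact hF.nonneg y)
  have hdd := (hF.contDiff_fderiv.differentiable (by norm_num) 0).hasFDerivAt
  rw [hasFDerivAt_iff_isLittleO] at hdd
  obtain ⟨ρ, hρ, hball⟩ := Metric.eventually_nhds_iff.1 (hdd.def (half_pos hc))
  refine ⟨c / 4, ρ, by positivity, hρ, fun v hv => ?_⟩
  have hkey : ∀ z, ‖z‖ < ρ → c / 2 * ‖z‖ ^ 2 ≤ fderiv ℝ F z z := fun z hz => by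
    have h := hball (y := z) (by simpa using hz)
    simp only [hd0, sub_zero] at h
    have h2 := (ContinuousLinearMap.le_opNorm (fderiv ℝ F z - fderiv ℝ (fderiv ℝ F) 0 z) z).trans
      (mul_le_mul_of_nonneg_right h (norm_nonneg z))
    rw [sub_apply, Real.norm_eq_abs] at h2
    nlinarith [(abs_le.1 h2).1, hH z]
  have hder : ∀ t : ℝ, HasDerivAt (fun t : ℝ => F (t • v) - c / 4 * ‖v‖ ^ 2 * t ^ 2)
      (fderiv ℝ F (t • v) v - c / 2 * ‖v‖ ^ 2 * t) t := fun t => by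
    have h1 : HasDerivAt (fun t : ℝ => t • v) v t := by
      simpa using (hasDerivAt_id t).smul_const v
    have h2 := (hF.differentiable (t • v)).hasFDerivAt.comp_hasDerivAt t h1
    have h3 := h2.sub ((hasDerivAt_pow 2 t).const_mul (c / 4 * ‖v‖ ^ 2))
    refine h3.congr_deriv ?_
    push_cast
    ring
  have hmono : MonotoneOn (fun t : ℝ => F (t • v) - c / 4 * ‖v‖ ^ 2 * t ^ 2) (Set.Icc 0 1) := by
    refine monotoneOn_of_deriv_nonneg (convex_Icc 0 1)
      (fun t _ => (hder t).continuousAt.continuousWithinAt)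
      (fun t _ => (hder t).differentiableAt.differentiableWithinAt) fun t ht => ?_
    rw [interior_Icc] at ht
    rw [(hder t).deriv]
    have hz : ‖t • v‖ < ρ := by
      rw [norm_smul, Real.norm_of_nonneg ht.1.le]
      nlinarith [norm_nonneg v, ht.2]
    have h := hkey _ hz
    rw [norm_smul, Real.norm_of_nonneg ht.1.le, map_smul, smul_eq_mul] at h
    have h' : t * (c / 2 * ‖v‖ ^ 2 * t) ≤ t * fderiv ℝ F (t • v) v := by linarith
    linarith [le_of_mul_le_mul_left h' ht.1]
  have h := hmono (Set.left_mem_Icc.2 zero_le_one) (Set.right_mem_Icc.2 zero_le_one) zero_le_one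
  simp only [zero_smul, one_smul, hF.map_zero] at h
  linarith

theorem exists_quadratic_le (hF : IsKickPotential F) :
    ∃ c : ℝ, 0 < c ∧ ∀ y, ∃ k, c * ‖y - intVec k‖ ^ 2 ≤ F y := by
  obtain ⟨c, ρ, hc, hρ, hloc⟩ := hF.exists_local_quadratic_le
  set K := Metric.closedBall (0 : EuclideanSpace ℝ (Fin d)) (Real.sqrt d) \
    ⋃ k, Metric.ball (intVec k) ρ with hK
  have hKc : IsCompact K :=
    (isCompact_closedBall _ _).diff (isOpen_iUnion fun k => Metric.isOpen_ball)
  obtain ⟨m, hm, hmK⟩ : ∃ m : ℝ, 0 < m ∧ ∀ y ∈ K, m ≤ F y := by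
    rcases K.eq_empty_or_nonempty with he | hne
    · exact ⟨1, one_pos, by simp [he]⟩
    · obtain ⟨w, hw, hmin⟩ := hKc.exists_isMinOn hne hF.continuous.continuousOn
      refine ⟨F w, ?_, fun y hy => hmin hy⟩
      by_contra! hle
      obtain ⟨k, rfl⟩ := hF.exists_eq_intVec hle
      exact hw.2 (Set.mem_iUnion.2 ⟨k, Metric.mem_ball_self hρ⟩)
  -- Away from the lattice, `F ≥ m` while the squared distance is at most `d`; `d + 1` avoids
  -- division by zero when `d = 0`.
  refine ⟨min c (m / (d + 1)), lt_min hc (by positivity), fun y => ?_⟩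
  by_cases h : ∃ k, ‖y - intVec k‖ < ρ
  · obtain ⟨k, hk⟩ := h
    refine ⟨k, le_trans ?_ ((hloc _ hk).trans_eq (hF.periodic.sub k y))⟩
    gcongr
    exact min_le_left _ _
  · push Not at h
    obtain ⟨k, hk⟩ := exists_norm_sub_intVec_le y
    refine ⟨k, ?_⟩
    have hyK : y - intVec k ∈ K := by
      refine ⟨by simpa using hk, fun hmem => ?_⟩
      obtain ⟨j, hj⟩ := Set.mem_iUnion.1 hmem
      refine (h (k + j)).not_gt ?_
      rw [mem_ball_iff_norm] at hj
      have e : intVec (k + j) = intVec k + intVec j := by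
        ext i; simp [intVec]
      rwa [e, ← sub_sub]
    have h1 := hmK _ hyK
    rw [hF.periodic.sub] at h1
    refine le_trans ?_ h1
    have h2 : ‖y - intVec k‖ ^ 2 ≤ d + 1 := by
      have := pow_le_pow_left₀ (norm_nonneg _) hk 2
      rw [Real.sq_sqrt (Nat.cast_nonneg d)] at this
      linarith
    calc _ ≤ m / (d + 1) * (d + 1) := by
          gcongr
          exact min_le_right _ _
      _ = m := by field_simp

end IsKickPotential

/-! ### The weak KAM solution and its calibration defect. -/

/-- The excess `ψ(y) + h(y, x) - ψ(x)` of the calibration inequality. -/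
noncomputable def defect {d : ℕ} (F ψ : EuclideanSpace ℝ (Fin d) → ℝ)
    (y x : EuclideanSpace ℝ (Fin d)) : ℝ :=
  ψ y + genFun F y x - ψ x

namespace IsWeakKAM

variable {d : ℕ} {F ψ : EuclideanSpace ℝ (Fin d) → ℝ}

theorem le_add_genFun (hψ : IsWeakKAM F ψ) (y x : EuclideanSpace ℝ (Fin d)) :
    ψ x ≤ ψ y + genFun F y x := (hψ.fixed x).2 ⟨y, rfl⟩

theorem defect_nonneg (hψ : IsWeakKAM F ψ) (y x : EuclideanSpace ℝ (Fin d)) :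
    0 ≤ defect F ψ y x := sub_nonneg.2 (hψ.le_add_genFun y x)

theorem exists_eq_add_genFun (hψ : IsWeakKAM F ψ) (x : EuclideanSpace ℝ (Fin d)) :
    ∃ y, ψ x = ψ y + genFun F y x := by
  obtain ⟨y, hy⟩ := (hψ.fixed x).1
  exact ⟨y, hy.symm⟩

theorem map_intVec (hψ : IsWeakKAM F ψ) (k : Fin d → ℤ) : ψ (intVec k) = 0 := by
  rw [hψ.periodic.map_intVec, hψ.map_zero]

theorem le_half_norm_sub_sq (hψ : IsWeakKAM F ψ) (hF : IsKickPotential F) (k : Fin d → ℤ)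
    (x : EuclideanSpace ℝ (Fin d)) : ψ x ≤ 1 / 2 * ‖x - intVec k‖ ^ 2 := by
  simpa [genFun, hψ.map_intVec, hF.map_intVec] using hψ.le_add_genFun (intVec k) x

theorem nonneg (hψ : IsWeakKAM F ψ) (hF : IsKickPotential F) (x : EuclideanSpace ℝ (Fin d)) :
    0 ≤ ψ x := by
  obtain ⟨w, -, hw⟩ := (isCompact_closedBall (0 : EuclideanSpace ℝ (Fin d))
    (Real.sqrt d)).exists_isMinOn ⟨0, by simp⟩ hψ.continuous.continuousOn
  have hmin : ∀ x, ψ w ≤ ψ x := fun x => by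
    obtain ⟨k, hk⟩ := exists_norm_sub_intVec_le x
    rw [← hψ.periodic.sub k x]
    exact hw (show x - intVec k ∈ _ by simpa using hk)
  -- A calibrating point of a minimizer of `ψ` must be a zero of `F`, hence a lattice point, where
  -- `ψ` vanishes.
  obtain ⟨y, hy⟩ := hψ.exists_eq_add_genFun w
  have hFy : F y ≤ 0 := by
    rw [genFun] at hy
    nlinarith [hmin y, sq_nonneg ‖w - y‖]
  obtain ⟨k, rfl⟩ := hF.exists_eq_intVec hFy
  have h0 := hψ.map_intVec k
  rw [genFun, hF.map_intVec, h0] at hy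
  nlinarith [hmin x, sq_nonneg ‖w - intVec k‖]

theorem exists_quadratic_le (hψ : IsWeakKAM F ψ) (hF : IsKickPotential F) :
    ∃ c : ℝ, 0 < c ∧ ∀ x, ∃ k, c * ‖x - intVec k‖ ^ 2 ≤ ψ x := by
  obtain ⟨c, hc, h⟩ := hF.exists_quadratic_le
  refine ⟨min (1 / 4) (c / 2), by positivity, fun x => ?_⟩
  obtain ⟨y, hy⟩ := hψ.exists_eq_add_genFun x
  obtain ⟨k, hk⟩ := h y
  refine ⟨k, ?_⟩
  rw [hy, genFun]
  have h1 : ‖x - intVec k‖ ≤ ‖x - y‖ + ‖y - intVec k‖ := norm_sub_le_norm_sub_add_norm_sub _ _ _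
  have h2 : ‖x - intVec k‖ ^ 2 ≤ 2 * ‖x - y‖ ^ 2 + 2 * ‖y - intVec k‖ ^ 2 := by
    nlinarith [norm_nonneg (x - intVec k), sq_nonneg (‖x - y‖ - ‖y - intVec k‖)]
  have h3 : 0 < min (1 / 4) (c / 2) := by positivity
  have h4 := min_le_left (1 / 4) (c / 2)
  have h5 := min_le_right (1 / 4) (c / 2)
  nlinarith [hψ.nonneg hF y, sq_nonneg ‖x - y‖, sq_nonneg ‖y - intVec k‖]

theorem exists_mul_le_potential (hψ : IsWeakKAM F ψ) (hF : IsKickPotential F) :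
    ∃ κ : ℝ, 0 < κ ∧ ∀ y, κ * ψ y ≤ F y := by
  obtain ⟨c, hc, h⟩ := hF.exists_quadratic_le
  refine ⟨2 * c, by positivity, fun y => ?_⟩
  obtain ⟨k, hk⟩ := h y
  nlinarith [hψ.le_half_norm_sub_sq hF k y]

/-- The defect in its first variable is semiconcave near `y`: comparing `y ± v` with a calibrating
`w` for `y` bounds the second difference of `ψ` by `|v|²`, the kinetic term adds `|v|²` and `F` adds
`M|v|²`. Since the defect vanishes at `y` and is nonnegative at `y - v`, the bound passes to `y +
v`. -/
theorem defect_le_of_eq (hψ : IsWeakKAM F ψ) {M : ℝ}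
    (hM : ∀ y v, F (y + v) + F (y - v) - 2 * F y ≤ M * ‖v‖ ^ 2)
    {x y : EuclideanSpace ℝ (Fin d)} (hy : ψ x = ψ y + genFun F y x)
    (z : EuclideanSpace ℝ (Fin d)) : defect F ψ z x ≤ (2 + M) * ‖z - y‖ ^ 2 := by
  obtain ⟨w, hw⟩ := hψ.exists_eq_add_genFun y
  set v := z - y with hv
  have hz : z = y + v := by simp [hv]
  have hpar : ∀ a : EuclideanSpace ℝ (Fin d),
      ‖a + v‖ ^ 2 + ‖a - v‖ ^ 2 = 2 * ‖a‖ ^ 2 + 2 * ‖v‖ ^ 2 := fun a => by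
    have := parallelogram_law_with_norm ℝ a v
    nlinarith
  have e1 : x - (y + v) = (x - y) - v := by abel
  have e2 : x - (y - v) = (x - y) + v := by abel
  have e3 : y + v - w = (y - w) + v := by abel
  have e4 : y - v - w = (y - w) - v := by abel
  have h1 := hψ.le_add_genFun w (y + v)
  have h2 := hψ.le_add_genFun w (y - v)
  have h3 := hψ.le_add_genFun (y - v) x
  have h4 := hM y v
  simp only [defect, hz, genFun, e1, e2, e3, e4] at *
  have h5 := hpar (x - y)
  have h6 := hpar (y - w)
  linarith

theorem defect_ge_of_lt (hκ : ∀ y, κ * ψ y ≤ F y) (hκ0 : 0 < κ)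
    {y x : EuclideanSpace ℝ (Fin d)} (h : (1 + κ / 2)⁻¹ * ψ x < ψ y) :
    κ / 2 * ψ y + 1 / 2 * ‖y - x‖ ^ 2 ≤ defect F ψ y x := by
  rw [inv_mul_lt_iff₀ (by positivity)] at h
  rw [defect, genFun, norm_sub_rev y x]
  linarith [hκ y]

/-- A zero defect would put `y` in `dMinus`, so off `U` the defect is positive; compactness modulo
the lattice makes this uniform for bounded `y - x`, and quadratic growth covers the rest. -/
theorem exists_defect_ge_of_notMem (hψ : IsWeakKAM F ψ) (hF : IsKickPotential F)
    {U : Set (EuclideanSpace ℝ (Fin d))} (hU : IsOpen U) (hUper : IsPeriodicSet U)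
    (hUD : dMinus F ψ ⊆ U) :
    ∃ δ t : ℝ, 0 < δ ∧ 0 < t ∧ ∀ y ∉ U, ∀ x, δ + t * ‖y - x‖ ^ 2 ≤ defect F ψ y x := by
  obtain ⟨B, hB, hψB⟩ := hψ.periodic.exists_norm_le hψ.continuous
  have hfar : ∀ y x, 1 / 2 * ‖y - x‖ ^ 2 - B ≤ defect F ψ y x := fun y x => by
    rw [defect, genFun, norm_sub_rev y x]
    linarith [hF.nonneg y, hψ.nonneg hF y, (abs_le.1 (hψB x)).2]
  set R := 2 * (B + 1) with hR
  set K := (Metric.closedBall (0 : EuclideanSpace ℝ (Fin d)) (Real.sqrt d) \ U) ×ˢ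
    Metric.closedBall (0 : EuclideanSpace ℝ (Fin d)) R with hK
  have hKc : IsCompact K := ((isCompact_closedBall _ _).diff hU).prod (isCompact_closedBall _ _)
  have hcont : Continuous fun z : EuclideanSpace ℝ (Fin d) × EuclideanSpace ℝ (Fin d) =>
      defect F ψ z.1 (z.1 + z.2) := by
    have h1 := hψ.continuous
    have h2 := hF.continuous
    unfold defect genFun
    fun_prop
  have hpos : ∀ y ∉ U, ∀ x, 0 < defect F ψ y x := fun y hy x => by
    refine lt_of_le_of_ne (hψ.defect_nonneg y x) fun h => hy (hUD ⟨x, fun z => ?_⟩)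
    rw [defect] at h
    linarith [hψ.le_add_genFun z x]
  obtain ⟨m, hm, hmK⟩ : ∃ m : ℝ, 0 < m ∧ ∀ z ∈ K, m ≤ defect F ψ z.1 (z.1 + z.2) := by
    rcases K.eq_empty_or_nonempty with he | hne
    · exact ⟨1, one_pos, by simp [he]⟩
    · obtain ⟨w, hw, hmin⟩ := hKc.exists_isMinOn hne hcont.continuousOn
      exact ⟨_, hpos _ hw.1.2 _, fun y hy => hmin hy⟩
  have hper : ∀ k y x, defect F ψ (y - intVec k) (x - intVec k) = defect F ψ y x := fun k y x => by
    simp only [defect, genFun, hψ.periodic.sub, hF.periodic.sub, sub_sub_sub_cancel_right]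
  have hR1 : B + 1 ≤ R ^ 2 / 2 := by rw [hR]; nlinarith
  have hm' : ∀ y ∉ U, ∀ x, min m 1 ≤ defect F ψ y x := fun y hy x => by
    by_cases hfr : ‖y - x‖ ≤ R
    · obtain ⟨k, hk⟩ := exists_norm_sub_intVec_le y
      refine (min_le_left _ _).trans
        ((hmK (y - intVec k, x - y) ⟨⟨by simpa using hk, ?_⟩, ?_⟩).trans_eq ?_)
      · intro h
        exact hy (by simpa using (hUper k _).2 h)
      · simpa [norm_sub_rev] using hfr
      · rw [← hper k y x]
        rw [show y - intVec k + (x - y) = x - intVec k by abel]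
    · push Not at hfr
      have h1 : R ^ 2 ≤ ‖y - x‖ ^ 2 := by gcongr
      refine (min_le_right _ _).trans (le_trans ?_ (hfar y x))
      linarith
  have hmm : 0 < min m 1 := by positivity
  set μ := min m 1
  refine ⟨μ / 2, μ / (4 * (B + μ)), by positivity, by positivity, fun y hy x => ?_⟩
  have h1 := hm' y hy x
  have h2 := hfar y x
  rw [← sub_nonneg]
  -- A convex combination of the uniform bound `μ` and the far-field bound, weighted so that `μ / 2`
  -- survives.
  have h3 : defect F ψ y x - (μ / 2 + μ / (4 * (B + μ)) * ‖y - x‖ ^ 2) =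
      ((2 * B + μ) * (defect F ψ y x - μ) +
        μ * (defect F ψ y x - (1 / 2 * ‖y - x‖ ^ 2 - B))) / (2 * (B + μ)) := by
    field_simp
    ring
  rw [h3]
  have := sub_nonneg.2 h1
  have := sub_nonneg.2 h2
  positivity

end IsWeakKAM

/-! ### Gaussian integrals and scaling in `ν`. -/

/-- An unnormalized Gaussian density on `ℝ^d`, with total mass `(2 t)^{-d/2}`. -/
noncomputable def gaussDensity {d : ℕ} (ν t : ℝ) (x y : EuclideanSpace ℝ (Fin d)) : ℝ :=
  (4 * Real.pi * ν) ^ (-(d : ℝ) / 2) * Real.exp (-(t * ‖y - x‖ ^ 2) / (2 * ν))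

section Gauss

variable {d : ℕ} {ν t : ℝ}

theorem gaussDensity_nonneg (hν : 0 < ν) (x y : EuclideanSpace ℝ (Fin d)) :
    0 ≤ gaussDensity ν t x y := by
  unfold gaussDensity; positivity

theorem integral_gaussDensity (hν : 0 < ν) (ht : 0 < t) (x : EuclideanSpace ℝ (Fin d)) :
    ∫ y, gaussDensity ν t x y = (2 * t) ^ (-(d : ℝ) / 2) := by
  have hb : 0 < t / (2 * ν) := by positivity
  have h := GaussianFourier.integral_rexp_neg_mul_sq_norm (V := EuclideanSpace ℝ (Fin d)) hb
  rw [finrank_euclideanSpace, Fintype.card_fin] at h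
  unfold gaussDensity
  rw [integral_const_mul, integral_sub_right_eq_self (fun y : EuclideanSpace ℝ (Fin d) =>
    Real.exp (-(t * ‖y‖ ^ 2) / (2 * ν))) x]
  have e : ∀ y : EuclideanSpace ℝ (Fin d), -(t * ‖y‖ ^ 2) / (2 * ν) = -(t / (2 * ν)) * ‖y‖ ^ 2 :=
    fun y => by ring
  simp only [e]
  rw [h, show Real.pi / (t / (2 * ν)) = 4 * Real.pi * ν / (2 * t) by field_simp; ring,
    Real.div_rpow (by positivity) (by positivity), neg_div, Real.rpow_neg (by positivity),
    Real.rpow_neg (by positivity)]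
  have : 0 < (4 * Real.pi * ν) ^ ((d : ℝ) / 2) := by positivity
  field_simp

theorem integrable_gaussDensity (hν : 0 < ν) (ht : 0 < t) (x : EuclideanSpace ℝ (Fin d)) :
    Integrable (gaussDensity ν t x) := by
  -- A non-integrable function has integral `0` by convention, whereas the computed value is
  -- positive.
  by_contra h
  have h1 := integral_gaussDensity hν ht x
  rw [integral_undef h] at h1
  have : 0 < (2 * t) ^ (-(d : ℝ) / 2) := by positivity
  exact this.ne h1

theorem integral_gaussDensity_half (hν : 0 < ν) (x : EuclideanSpace ℝ (Fin d)) :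
    ∫ y, gaussDensity ν (1 / 2) x y = 1 := by
  rw [integral_gaussDensity hν (by norm_num)]
  norm_num

theorem exists_forall_rpow_mul_exp_le (s A : ℝ) {b : ℝ} (hb : 0 < b) :
    ∃ ν₁ : ℝ, 0 < ν₁ ∧ ∀ ν, 0 < ν → ν < ν₁ → A * (ν ^ (-s) * Real.exp (-b / ν)) ≤ 1 := by
  have h := ((tendsto_rpow_mul_exp_neg_mul_atTop_nhds_zero s b hb).const_mul A).eventually
    (gt_mem_nhds (show A * 0 < 1 by simp))
  obtain ⟨T, hT⟩ := Filter.eventually_atTop.1 h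
  refine ⟨(max T 1)⁻¹, by positivity, fun ν hν hν1 => ?_⟩
  have hle : T ≤ ν⁻¹ := (le_max_left T 1).trans ((lt_inv_comm₀ hν (by positivity)).1 hν1).le
  have h1 := (hT _ hle).le
  rwa [Real.inv_rpow hν.le, ← Real.rpow_neg hν.le, ← div_eq_mul_inv] at h1

theorem setIntegral_ball_intVec {u : EuclideanSpace ℝ (Fin d) → ℝ} (hu : IsPeriodic u)
    (k : Fin d → ℤ) (r : ℝ) :
    ∫ y in Metric.ball (intVec k) r, u y = ∫ y in Metric.ball 0 r, u y := by
  rw [← integral_indicator Metric.isOpen_ball.measurableSet,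
    ← integral_indicator Metric.isOpen_ball.measurableSet,
    ← integral_add_right_eq_self _ (intVec k)]
  congr 1 with y
  simp only [Set.indicator, Metric.mem_ball, dist_eq_norm, add_sub_cancel_right, sub_zero, hu k y]

theorem rpow_mul_volume_ball_sqrt (hν : 0 < ν) (k : EuclideanSpace ℝ (Fin d)) :
    (4 * Real.pi * ν) ^ (-(d : ℝ) / 2) * volume.real (Metric.ball k (Real.sqrt ν)) =
      (4 * Real.pi) ^ (-(d : ℝ) / 2) *
        volume.real (Metric.ball (0 : EuclideanSpace ℝ (Fin d)) 1) := by
  have hs : 0 < Real.sqrt ν := Real.sqrt_pos.2 hν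
  rw [Measure.real, Measure.addHaar_ball_of_pos _ _ hs, ENNReal.toReal_mul,
    ENNReal.toReal_ofReal (by positivity), finrank_euclideanSpace, Fintype.card_fin,
    ← Measure.real, Real.mul_rpow (by positivity) hν.le]
  have e : ν ^ (-(d : ℝ) / 2) * Real.sqrt ν ^ d = 1 := by
    rw [Real.sqrt_eq_rpow, ← Real.rpow_natCast, ← Real.rpow_mul hν.le, ← Real.rpow_add hν]
    ring_nf
    exact Real.rpow_zero ν
  linear_combination ((4 * Real.pi) ^ (-(d : ℝ) / 2) *
    volume.real (Metric.ball (0 : EuclideanSpace ℝ (Fin d)) 1)) * e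

end Gauss

/-! ### Elementary bounds on `χ`. -/

section Chi

variable {d : ℕ} {U : Set (EuclideanSpace ℝ (Fin d))} {ν : ℝ}

theorem one_le_chi (hν : 0 < ν) (hν1 : ν ≤ 1) (x : EuclideanSpace ℝ (Fin d)) : 1 ≤ chi U ν x := by
  unfold chi
  split_ifs
  · exact le_rfl
  · exact Real.one_le_rpow_of_pos_of_le_one_of_nonpos hν hν1
      (by have := Nat.cast_nonneg (α := ℝ) d; linarith)

theorem chi_le (hν : 0 < ν) (hν1 : ν ≤ 1) (x : EuclideanSpace ℝ (Fin d)) :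
    chi U ν x ≤ ν ^ (-(d : ℝ) / 2) := by
  unfold chi
  split_ifs
  · exact Real.one_le_rpow_of_pos_of_le_one_of_nonpos hν hν1
      (by have := Nat.cast_nonneg (α := ℝ) d; linarith)
  · exact le_rfl

theorem measurable_chi (hU : IsOpen U) : Measurable (chi U ν) := by
  unfold chi
  exact Measurable.ite hU.measurableSet measurable_const measurable_const

end Chi

/-! ### Pointwise estimates for the conjugate kernel. -/

section Kernel

variable {d : ℕ} {F ψ : EuclideanSpace ℝ (Fin d) → ℝ} {ν : ℝ}

theorem conjKernel_eq (y x : EuclideanSpace ℝ (Fin d)) :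
    conjKernel F ψ ν y x =
      (4 * Real.pi * ν) ^ (-(d : ℝ) / 2) * Real.exp (-defect F ψ y x / (2 * ν)) := by
  rw [conjKernel, heatKernel, mul_comm (Real.exp _), mul_assoc, mul_assoc, ← Real.exp_add,
    ← Real.exp_add, defect]
  congr 2
  ring

theorem conjKernel_pos (hν : 0 < ν) (y x : EuclideanSpace ℝ (Fin d)) :
    0 < conjKernel F ψ ν y x := by
  rw [conjKernel_eq]; positivity

theorem conjKernel_le (hν : 0 < ν) {e t : ℝ} {y x : EuclideanSpace ℝ (Fin d)}
    (h : e + t * ‖y - x‖ ^ 2 ≤ defect F ψ y x) :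
    conjKernel F ψ ν y x ≤ Real.exp (-e / (2 * ν)) * gaussDensity ν t x y := by
  rw [conjKernel_eq, gaussDensity, mul_left_comm, ← Real.exp_add, ← add_div]
  gcongr
  linarith

theorem gaussDensity_le_conjKernel (hν : 0 < ν) {t : ℝ} {y z x : EuclideanSpace ℝ (Fin d)}
    (h : defect F ψ z x ≤ t * ‖z - y‖ ^ 2) : gaussDensity ν t y z ≤ conjKernel F ψ ν z x := by
  rw [conjKernel_eq, gaussDensity]
  gcongr

theorem continuous_conjKernel (hF : Continuous F) (hψ : Continuous ψ) :
    Continuous fun z : EuclideanSpace ℝ (Fin d) × EuclideanSpace ℝ (Fin d) =>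
      conjKernel F ψ ν z.2 z.1 := by
  unfold conjKernel heatKernel genFun
  fun_prop

theorem stronglyMeasurable_partitionFun (hF : Continuous F) (hψ : Continuous ψ) (n : ℕ) :
    StronglyMeasurable (partitionFun F ψ ν n) := by
  induction n with
  | zero => exact stronglyMeasurable_const
  | succ n ih =>
    rw [partitionFun, Function.iterate_succ_apply', ← partitionFun]
    unfold conjOp
    refine StronglyMeasurable.integral_prod_right (f := fun x y =>
      conjKernel F ψ ν y x * partitionFun F ψ ν n y) ?_
    exact (continuous_conjKernel hF hψ).stronglyMeasurable.mul (ih.comp_measurable measurable_snd)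

theorem integrable_conjKernel (hF : IsKickPotential F) (hψ : IsWeakKAM F ψ) (hν : 0 < ν)
    (x : EuclideanSpace ℝ (Fin d)) : Integrable fun y => conjKernel F ψ ν y x := by
  refine Integrable.mono' ((integrable_gaussDensity hν (one_half_pos (α := ℝ)) x).const_mul
    (Real.exp (-(-ψ x) / (2 * ν)))) ?_ (Filter.Eventually.of_forall fun y => ?_)
  · exact ((continuous_conjKernel hF.continuous hψ.continuous).comp
      (Continuous.prodMk_right x)).aestronglyMeasurable
  · rw [Real.norm_of_nonneg (conjKernel_pos hν y x).le]
    refine conjKernel_le hν ?_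
    rw [defect, genFun, norm_sub_rev y x]
    linarith [hF.nonneg y, hψ.nonneg hF y]

/-- Around a calibrating point the kernel dominates a Gaussian whose mass does not depend on `ν`. -/
theorem le_integral_conjKernel (hF : IsKickPotential F) (hψ : IsWeakKAM F ψ) (hν : 0 < ν)
    {M : ℝ} (hM0 : 0 < M) (hM : ∀ y v, F (y + v) + F (y - v) - 2 * F y ≤ M * ‖v‖ ^ 2)
    (x : EuclideanSpace ℝ (Fin d)) :
    (2 * (2 + M)) ^ (-(d : ℝ) / 2) ≤ ∫ y, conjKernel F ψ ν y x := by
  obtain ⟨y, hy⟩ := hψ.exists_eq_add_genFun x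
  rw [← integral_gaussDensity hν (by positivity : 0 < 2 + M) y]
  exact integral_mono (integrable_gaussDensity hν (by positivity) y)
    (integrable_conjKernel hF hψ hν x)
    fun z => gaussDensity_le_conjKernel hν (hψ.defect_le_of_eq hM hy z)

theorem mul_exp_neg_div_le {κ s : ℝ} (hν : 0 < ν) (hκ : 0 < κ) :
    Real.exp (-(κ / 2 * s) / (2 * ν)) * s ≤ 4 * ν / κ := by
  have h : κ * s / (4 * ν) ≤ Real.exp (κ * s / (4 * ν)) := by
    linarith [Real.add_one_le_exp (κ * s / (4 * ν))]
  rw [show -(κ / 2 * s) / (2 * ν) = -(κ * s / (4 * ν)) by ring, Real.exp_neg,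
    inv_mul_le_iff₀ (Real.exp_pos _)]
  calc s = κ * s / (4 * ν) * (4 * ν / κ) := by field_simp
    _ ≤ _ := by gcongr

theorem conjKernel_mul_chi_le (hν : 0 < ν) {U : Set (EuclideanSpace ℝ (Fin d))} {δ t R : ℝ}
    (hF : ∀ y, 0 ≤ F y) (hψ : ∀ y, 0 ≤ ψ y)
    (hδ : ∀ y ∉ U, ∀ x, δ + t * ‖y - x‖ ^ 2 ≤ defect F ψ y x)
    {x : EuclideanSpace ℝ (Fin d)} (hx : ψ x ≤ R * ν) (y : EuclideanSpace ℝ (Fin d)) :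
    conjKernel F ψ ν y x * chi U ν y ≤ Real.exp (R / 2) * gaussDensity ν (1 / 2) x y +
      ν ^ (-(d : ℝ) / 2) * Real.exp (-δ / (2 * ν)) * gaussDensity ν t x y := by
  have h1 := mul_nonneg (Real.exp_pos (R / 2)).le (gaussDensity_nonneg (t := 1 / 2) hν x y)
  have h2 : 0 ≤ ν ^ (-(d : ℝ) / 2) * Real.exp (-δ / (2 * ν)) * gaussDensity ν t x y :=
    mul_nonneg (by positivity) (gaussDensity_nonneg hν x y)
  by_cases hy : y ∈ U
  · have h : -(R * ν) + 1 / 2 * ‖y - x‖ ^ 2 ≤ defect F ψ y x := by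
      rw [defect, genFun, norm_sub_rev y x]
      linarith [hF y, hψ y]
    have h3 := conjKernel_le hν h
    rw [show -(-(R * ν)) / (2 * ν) = R / 2 by field_simp] at h3
    rw [chi, if_pos hy]
    linarith
  · have h3 := mul_le_mul_of_nonneg_right (conjKernel_le hν (hδ y hy x))
      (Real.rpow_nonneg hν.le (-(d : ℝ) / 2))
    rw [chi, if_neg hy]
    linarith

/-- The part of the drift integral that does not contract. On `U`, the exponential decay in `ψ(y) /
ν` turns the factor `ψ(y)` into `O(ν)`; off `U`, the cube collects one `χ` from the partition
function and two from `V`. -/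
theorem conjKernel_mul_chi_mul_lyapunov_le (hν : 0 < ν) {U : Set (EuclideanSpace ℝ (Fin d))}
    {δ t κ B : ℝ} (hψ : ∀ y, 0 ≤ ψ y) (hψB : ∀ y, ψ y ≤ B)
    (hδ : ∀ y ∉ U, ∀ x, δ + t * ‖y - x‖ ^ 2 ≤ defect F ψ y x)
    (hκ0 : 0 < κ) (hκ : ∀ y, κ * ψ y ≤ F y) {y x : EuclideanSpace ℝ (Fin d)}
    (h : y ∈ U → (1 + κ / 2)⁻¹ * ψ x < ψ y) :
    conjKernel F ψ ν y x * chi U ν y * lyapunov ψ U ν y ≤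
      4 * ν / κ * gaussDensity ν (1 / 2) x y +
        B * (ν ^ (-(d : ℝ) / 2)) ^ 3 * Real.exp (-δ / (2 * ν)) * gaussDensity ν t x y := by
  have hB : 0 ≤ B := (hψ 0).trans (hψB 0)
  have h1 : 0 ≤ 4 * ν / κ * gaussDensity ν (1 / 2) x y :=
    mul_nonneg (by positivity) (gaussDensity_nonneg hν x y)
  have h2 : 0 ≤ B * (ν ^ (-(d : ℝ) / 2)) ^ 3 * Real.exp (-δ / (2 * ν)) * gaussDensity ν t x y :=
    mul_nonneg (by positivity) (gaussDensity_nonneg hν x y)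
  by_cases hy : y ∈ U
  · have h3 := conjKernel_le hν (IsWeakKAM.defect_ge_of_lt hκ hκ0 (h hy))
    have h4 := mul_le_mul_of_nonneg_right h3 (hψ y)
    have h5 := mul_le_mul_of_nonneg_right (mul_exp_neg_div_le (s := ψ y) hν hκ0)
      (gaussDensity_nonneg (t := 1 / 2) hν x y)
    rw [lyapunov, chi, if_pos hy]
    linarith
  · have h3 := conjKernel_le hν (hδ y hy x)
    have h4 : conjKernel F ψ ν y x * ψ y ≤
        Real.exp (-δ / (2 * ν)) * gaussDensity ν t x y * B :=
      mul_le_mul h3 (hψB y) (hψ y) (mul_nonneg (Real.exp_pos _).le (gaussDensity_nonneg hν x y))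
    have h5 := mul_le_mul_of_nonneg_right h4
      (by positivity : 0 ≤ (ν ^ (-(d : ℝ) / 2)) ^ 3)
    rw [lyapunov, chi, if_neg hy]
    linarith

end Kernel

/-! ### Normalizer, drift and minorization for one step. -/

section OneStep

variable {d : ℕ} {F ψ p : EuclideanSpace ℝ (Fin d) → ℝ} {U : Set (EuclideanSpace ℝ (Fin d))}
  {ν D Q : ℝ}

theorem partitionFun_succ (n : ℕ) (x : EuclideanSpace ℝ (Fin d)) :
    partitionFun F ψ ν (n + 1) x = ∫ y, conjKernel F ψ ν y x * partitionFun F ψ ν n y := by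
  rw [partitionFun, Function.iterate_succ_apply', ← partitionFun, conjOp]

theorem integrable_conjKernel_mul (hF : IsKickPotential F) (hψ : IsWeakKAM F ψ) (hν : 0 < ν)
    (hν1 : ν ≤ 1) (hp : StronglyMeasurable p) (hp0 : ∀ y, 0 ≤ p y) (hQD : 0 ≤ Q * D)
    (hpQ : ∀ y, p y ≤ Q * D * chi U ν y) (x : EuclideanSpace ℝ (Fin d)) :
    Integrable fun y => conjKernel F ψ ν y x * p y := by
  refine (integrable_conjKernel hF hψ hν x).mul_bdd (c := Q * D * ν ^ (-(d : ℝ) / 2))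
    hp.aestronglyMeasurable (Filter.Eventually.of_forall fun y => ?_)
  rw [Real.norm_of_nonneg (hp0 y)]
  exact (hpQ y).trans (mul_le_mul_of_nonneg_left (chi_le hν hν1 y) hQD)

theorem le_integral_conjKernel_mul (hF : IsKickPotential F) (hψ : IsWeakKAM F ψ) (hν : 0 < ν)
    {M : ℝ} (hM0 : 0 < M) (hM : ∀ y v, F (y + v) + F (y - v) - 2 * F y ≤ M * ‖v‖ ^ 2)
    (hD : 0 < D) (hQ : 0 < Q) {x : EuclideanSpace ℝ (Fin d)}
    (hi : Integrable fun y => conjKernel F ψ ν y x * p y) (hpQ : ∀ y, Q / D ≤ p y) :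
    Q / D * (2 * (2 + M)) ^ (-(d : ℝ) / 2) ≤ ∫ y, conjKernel F ψ ν y x * p y := by
  calc _ ≤ Q / D * ∫ y, conjKernel F ψ ν y x := by
        gcongr
        exact le_integral_conjKernel hF hψ hν hM0 hM x
    _ = ∫ y, conjKernel F ψ ν y x * (Q / D) := by rw [integral_mul_const, mul_comm]
    _ ≤ _ := integral_mono ((integrable_conjKernel hF hψ hν x).mul_const _) hi fun y =>
        mul_le_mul_of_nonneg_left (hpQ y) (conjKernel_pos hν y x).le

theorem integral_conjKernel_mul_le (hF : IsKickPotential F) (hψ : IsWeakKAM F ψ) (hν : 0 < ν)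
    (hQD : 0 ≤ Q * D) {δ t R : ℝ} (ht : 0 < t)
    (hδ : ∀ y ∉ U, ∀ x, δ + t * ‖y - x‖ ^ 2 ≤ defect F ψ y x)
    (hsmall : ν ^ (-(d : ℝ) / 2) * Real.exp (-δ / (2 * ν)) * (2 * t) ^ (-(d : ℝ) / 2) ≤ 1)
    {x : EuclideanSpace ℝ (Fin d)} (hx : ψ x ≤ R * ν)
    (hi : Integrable fun y => conjKernel F ψ ν y x * p y)
    (hpQ : ∀ y, p y ≤ Q * D * chi U ν y) :
    ∫ y, conjKernel F ψ ν y x * p y ≤ Q * D * (Real.exp (R / 2) + 1) := by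
  have i1 := (integrable_gaussDensity hν (one_half_pos (α := ℝ)) x).const_mul (Real.exp (R / 2))
  have i2 := (integrable_gaussDensity hν ht x).const_mul
    (ν ^ (-(d : ℝ) / 2) * Real.exp (-δ / (2 * ν)))
  calc _ ≤ ∫ y, Q * D * (Real.exp (R / 2) * gaussDensity ν (1 / 2) x y +
        ν ^ (-(d : ℝ) / 2) * Real.exp (-δ / (2 * ν)) * gaussDensity ν t x y) := by
        refine integral_mono hi ((i1.add i2).const_mul _) fun y => ?_
        refine (mul_le_mul_of_nonneg_left (hpQ y) (conjKernel_pos hν y x).le).trans ?_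
        rw [mul_left_comm]
        exact mul_le_mul_of_nonneg_left
          (conjKernel_mul_chi_le hν hF.nonneg (hψ.nonneg hF) hδ hx y) hQD
    _ ≤ _ := by
        rw [integral_const_mul, integral_add i1 i2, integral_const_mul, integral_const_mul,
          integral_gaussDensity_half hν, integral_gaussDensity hν ht, mul_one]
        gcongr

theorem lyapunov_nonneg (hψ : ∀ y, 0 ≤ ψ y) (x : EuclideanSpace ℝ (Fin d)) :
    0 ≤ lyapunov ψ U ν x := mul_nonneg (hψ x) (sq_nonneg _)

theorem le_lyapunov (hψ : ∀ y, 0 ≤ ψ y) (hν : 0 < ν) (hν1 : ν ≤ 1)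
    (x : EuclideanSpace ℝ (Fin d)) : ψ x ≤ lyapunov ψ U ν x :=
  le_mul_of_one_le_right (hψ x) (one_le_pow₀ (one_le_chi hν hν1 x))

theorem integral_mul_lyapunov_le (hF : IsKickPotential F) (hψ : IsWeakKAM F ψ) (hν : 0 < ν)
    (hν1 : ν ≤ 1) {A B δ t κ : ℝ} (hA : 0 ≤ A) (hψB : ∀ y, ψ y ≤ B) (ht : 0 < t)
    (hδ : ∀ y ∉ U, ∀ x, δ + t * ‖y - x‖ ^ 2 ≤ defect F ψ y x)
    (hκ0 : 0 < κ) (hκ : ∀ y, κ * ψ y ≤ F y)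
    (hsmall : B * (ν ^ (-(d : ℝ) / 2)) ^ 3 * Real.exp (-δ / (2 * ν)) * (2 * t) ^ (-(d : ℝ) / 2) ≤ ν)
    {q : EuclideanSpace ℝ (Fin d) → ℝ} {x : EuclideanSpace ℝ (Fin d)} (hq0 : ∀ y, 0 ≤ q y)
    (hq : Integrable q) (hq1 : ∫ y, q y = 1)
    (hqV : Integrable fun y => q y * lyapunov ψ U ν y)
    (hqA : ∀ y, q y ≤ A * (conjKernel F ψ ν y x * chi U ν y)) :
    ∫ y, q y * lyapunov ψ U ν y ≤
      (1 + κ / 2)⁻¹ * lyapunov ψ U ν x + A * (4 / κ + 1) * ν := by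
  have hB : 0 ≤ B := (hψ.nonneg hF 0).trans (hψB 0)
  have i1 := (integrable_gaussDensity hν (one_half_pos (α := ℝ)) x).const_mul (4 * ν / κ)
  have i2 := (integrable_gaussDensity hν ht x).const_mul
    (B * (ν ^ (-(d : ℝ) / 2)) ^ 3 * Real.exp (-δ / (2 * ν)))
  have i3 : Integrable fun y => A * (4 * ν / κ * gaussDensity ν (1 / 2) x y +
      B * (ν ^ (-(d : ℝ) / 2)) ^ 3 * Real.exp (-δ / (2 * ν)) * gaussDensity ν t x y) :=
    (i1.add i2).const_mul A
  have hpt : ∀ y, q y * lyapunov ψ U ν y ≤ (1 + κ / 2)⁻¹ * ψ x * q y +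
      A * (4 * ν / κ * gaussDensity ν (1 / 2) x y +
        B * (ν ^ (-(d : ℝ) / 2)) ^ 3 * Real.exp (-δ / (2 * ν)) * gaussDensity ν t x y) := by
    intro y
    -- The negation is the contracting region: `y ∈ U`, where `V = ψ`, and `ψ(y) ≤ (1 + κ/2)⁻¹
    -- ψ(x)`.
    by_cases h : y ∈ U → (1 + κ / 2)⁻¹ * ψ x < ψ y
    · have h1 := conjKernel_mul_chi_mul_lyapunov_le hν (hψ.nonneg hF) hψB hδ hκ0 hκ h
      have h2 := mul_le_mul_of_nonneg_right (hqA y) (lyapunov_nonneg (U := U) (ν := ν)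
        (hψ.nonneg hF) y)
      have h3 := mul_le_mul_of_nonneg_left h1 hA
      have h4 : 0 ≤ (1 + κ / 2)⁻¹ * ψ x * q y :=
        mul_nonneg (mul_nonneg (by positivity) (hψ.nonneg hF x)) (hq0 y)
      linarith
    · push Not at h
      have h1 : lyapunov ψ U ν y = ψ y := by rw [lyapunov, chi, if_pos h.1]; ring
      have h2 := mul_le_mul_of_nonneg_left h.2 (hq0 y)
      have h3 := gaussDensity_nonneg (t := 1 / 2) hν x y
      have h4 := gaussDensity_nonneg (t := t) hν x y
      have h5 : 0 ≤ A * (4 * ν / κ * gaussDensity ν (1 / 2) x y +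
        B * (ν ^ (-(d : ℝ) / 2)) ^ 3 * Real.exp (-δ / (2 * ν)) * gaussDensity ν t x y) := by
        positivity
      rw [h1]
      linarith
  have h := integral_mono hqV ((hq.const_mul _).add i3) hpt
  refine h.trans ?_
  rw [integral_add' (hq.const_mul _) i3, integral_const_mul, integral_const_mul,
    integral_add i1 i2, integral_const_mul, integral_const_mul, hq1,
    integral_gaussDensity_half hν, integral_gaussDensity hν ht, mul_one, mul_one]
  have h1 : (1 + κ / 2)⁻¹ * ψ x ≤ (1 + κ / 2)⁻¹ * lyapunov ψ U ν x := by
    gcongr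
    exact le_lyapunov (hψ.nonneg hF) hν hν1 x
  have h2 := mul_le_mul_of_nonneg_left (add_le_add_right hsmall (4 * ν / κ)) hA
  have h3 : A * (4 * ν / κ + ν) = A * (4 / κ + 1) * ν := by ring
  linarith

theorem le_conjKernel_of_mem_ball (hF : IsKickPotential F) (hψ : IsWeakKAM F ψ) (hν : 0 < ν)
    {M c R : ℝ} (hM0 : 0 < M) (hM : ∀ y v, F (y + v) + F (y - v) - 2 * F y ≤ M * ‖v‖ ^ 2)
    (hc : 0 < c) {x y : EuclideanSpace ℝ (Fin d)} {k : Fin d → ℤ}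
    (hxk : c * ‖x - intVec k‖ ^ 2 ≤ ψ x) (hx : ψ x ≤ R * ν)
    (hy : y ∈ Metric.ball (intVec k) (Real.sqrt ν)) :
    (4 * Real.pi * ν) ^ (-(d : ℝ) / 2) * Real.exp (-(3 / 2 + M + R / c) / 2) ≤
      conjKernel F ψ ν y x := by
  rw [mem_ball_iff_norm] at hy
  have h1 : ‖y - intVec k‖ ^ 2 ≤ ν := by
    have := pow_le_pow_left₀ (norm_nonneg _) hy.le 2
    rwa [Real.sq_sqrt hν.le] at this
  have h2 : ‖x - intVec k‖ ^ 2 ≤ R / c * ν := by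
    rw [div_mul_eq_mul_div, le_div_iff₀ hc]
    linarith
  have h3 : ‖x - y‖ ≤ ‖x - intVec k‖ + ‖y - intVec k‖ := by
    rw [norm_sub_rev y]
    exact norm_sub_le_norm_sub_add_norm_sub _ _ _
  have h4 : ‖x - y‖ ^ 2 ≤ 2 * ‖x - intVec k‖ ^ 2 + 2 * ‖y - intVec k‖ ^ 2 := by
    nlinarith [norm_nonneg (x - y), sq_nonneg (‖x - intVec k‖ - ‖y - intVec k‖)]
  have h5 := hF.le_mul_norm_sub_sq hM k y
  have h6 := hψ.le_half_norm_sub_sq hF k y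
  have h7 : defect F ψ y x ≤ (3 / 2 + M + R / c) * ν := by
    rw [defect, genFun]
    nlinarith [hψ.nonneg hF x]
  rw [conjKernel_eq]
  gcongr ?_ * Real.exp ?_
  rw [le_div_iff₀ (by positivity)]
  linarith

end OneStep

/-! ### Assembling Harris' hypotheses and choosing constants. -/

theorem weightedOsc_markovOp_le {d : ℕ} {F ψ : EuclideanSpace ℝ (Fin d) → ℝ}
    (hF : IsKickPotential F) (hψ : IsWeakKAM F ψ) {U : Set (EuclideanSpace ℝ (Fin d))}
    (hU : IsOpen U) {ν D Q M c κ δ t B : ℝ} (hν : 0 < ν) (hν1 : ν ≤ 1)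
    (hM0 : 0 < M) (hM : ∀ y v, F (y + v) + F (y - v) - 2 * F y ≤ M * ‖v‖ ^ 2)
    (hc : 0 < c) (hcψ : ∀ x, ∃ k, c * ‖x - intVec k‖ ^ 2 ≤ ψ x) (hψB : ∀ y, ψ y ≤ B)
    (hκ0 : 0 < κ) (hκ : ∀ y, κ * ψ y ≤ F y) (ht : 0 < t)
    (hδ : ∀ y ∉ U, ∀ x, δ + t * ‖y - x‖ ^ 2 ≤ defect F ψ y x)
    (hsmall : ν ^ (-(d : ℝ) / 2) * Real.exp (-δ / (2 * ν)) * (2 * t) ^ (-(d : ℝ) / 2) ≤ 1)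
    (hsmall' :
      B * (ν ^ (-(d : ℝ) / 2)) ^ 3 * Real.exp (-δ / (2 * ν)) * (2 * t) ^ (-(d : ℝ) / 2) ≤ ν)
    {n : ℕ} (hD : 0 < D) (hQ : 0 < Q) (hlow : ∀ y, Q / D ≤ partitionFun F ψ ν n y)
    (hupp : ∀ y, partitionFun F ψ ν n y ≤ Q * D * chi U ν y)
    {C R b α α₁ : ℝ} (hC0 : 0 < C)
    (hC : D ^ 2 / (2 * (2 + M)) ^ (-(d : ℝ) / 2) * (4 / κ + 1) ≤ C) (hb0 : 0 < b)
    (hb : b ≤ Real.exp (-(3 / 2 + M + R / c) / 2) / (D ^ 2 * (Real.exp (R / 2) + 1)))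
    (hα₁ : 0 < α₁) (hα : 0 < α) (hγα : (1 + κ / 2)⁻¹ ≤ α)
    (haα : 1 - b * ((4 * Real.pi) ^ (-(d : ℝ) / 2) *
      volume.real (Metric.ball (0 : EuclideanSpace ℝ (Fin d)) 1)) + α₁ ≤ α)
    (hRα : 2 + 2 * α₁ + (1 + κ / 2)⁻¹ * (α₁ * R / C) ≤ α * (2 + α₁ * R / C))
    {u : EuclideanSpace ℝ (Fin d) → ℝ} (hu : AEMeasurable u) (hub : ∃ L : ℝ, ∀ x, |u x| ≤ L)
    (huper : IsPeriodic u) :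
    weightedOsc (α₁ / (C * ν)) (lyapunov ψ U ν) (markovOp F ψ ν n u) ≤
      ENNReal.ofReal α * weightedOsc (α₁ / (C * ν)) (lyapunov ψ U ν) u := by
  obtain ⟨L, hL⟩ := hub
  choose k hk using hcψ
  set ℓ := (2 * (2 + M)) ^ (-(d : ℝ) / 2) with hℓ
  have hℓ0 : 0 < ℓ := by positivity
  set p := partitionFun F ψ ν n with hp
  have hpm : StronglyMeasurable p :=
    stronglyMeasurable_partitionFun hF.continuous hψ.continuous n
  have hp0 : ∀ y, 0 ≤ p y := fun y => (by positivity : 0 ≤ Q / D).trans (hlow y)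
  have hQD : 0 ≤ Q * D := by positivity
  have hKp := integrable_conjKernel_mul hF hψ hν hν1 hpm hp0 hQD hupp
  set Z := partitionFun F ψ ν (n + 1) with hZ
  have hZe : ∀ x, Z x = ∫ y, conjKernel F ψ ν y x * p y := fun x => partitionFun_succ n x
  have hZlow : ∀ x, Q / D * ℓ ≤ Z x := fun x => by
    rw [hZe]
    exact le_integral_conjKernel_mul hF hψ hν hM0 hM hD hQ (hKp x) hlow
  have hZ0 : ∀ x, 0 < Z x := fun x => (by positivity : 0 < Q / D * ℓ).trans_le (hZlow x)
  have hVup : ∀ x, ψ x ≤ lyapunov ψ U ν x := le_lyapunov (hψ.nonneg hF) hν hν1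
  have hVm : Measurable (lyapunov ψ U ν) :=
    hψ.continuous.measurable.mul ((measurable_chi hU).pow_const 2)
  have hVb : ∀ y, ‖lyapunov ψ U ν y‖ ≤ B * (ν ^ (-(d : ℝ) / 2)) ^ 2 := fun y => by
    rw [Real.norm_of_nonneg (lyapunov_nonneg (hψ.nonneg hF) y)]
    exact mul_le_mul (hψB y) (pow_le_pow_left₀ (zero_le_one.trans (one_le_chi hν hν1 y))
      (chi_le hν hν1 y) 2) (sq_nonneg _) ((hψ.nonneg hF y).trans (hψB y))
  have hm0 : ∀ x y, 0 ≤ markovKernel F ψ ν n y x := fun x y =>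
    div_nonneg (mul_nonneg (conjKernel_pos hν y x).le (hp0 y)) (hZ0 x).le
  have hmi : ∀ x, Integrable fun y => markovKernel F ψ ν n y x := fun x =>
    (hKp x).div_const (Z x)
  have hm1 : ∀ x, ∫ y, markovKernel F ψ ν n y x = 1 := fun x => by
    have : ∫ y, markovKernel F ψ ν n y x = (∫ y, conjKernel F ψ ν y x * p y) / Z x :=
      integral_div _ _
    rw [this, ← hZe, div_self (hZ0 x).ne']
  have hmV : ∀ x, Integrable fun y => markovKernel F ψ ν n y x * lyapunov ψ U ν y := fun x =>
    (hmi x).mul_bdd hVm.aestronglyMeasurable (Filter.Eventually.of_forall hVb)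
  have hmu : ∀ x, Integrable fun y => markovKernel F ψ ν n y x * u y := fun x =>
    (hmi x).mul_bdd hu.aestronglyMeasurable (Filter.Eventually.of_forall hL)
  -- The scale `Q` cancels between numerator and normalizer, leaving `D ^ 2`.
  have hmA : ∀ x y, markovKernel F ψ ν n y x ≤
      D ^ 2 / ℓ * (conjKernel F ψ ν y x * chi U ν y) := fun x y => by
    have hK := (conjKernel_pos (F := F) (ψ := ψ) hν y x).le
    calc _ ≤ conjKernel F ψ ν y x * (Q * D * chi U ν y) / (Q / D * ℓ) :=
          div_le_div₀ (mul_nonneg hK ((hp0 y).trans (hupp y)))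
            (mul_le_mul_of_nonneg_left (hupp y) hK) (by positivity) (hZlow x)
      _ = _ := by field_simp
  set W := (4 * Real.pi) ^ (-(d : ℝ) / 2) *
      volume.real (Metric.ball (0 : EuclideanSpace ℝ (Fin d)) 1) with hW
  set G := b * (4 * Real.pi * ν) ^ (-(d : ℝ) / 2) with hG
  have hball : ∀ x, MeasurableSet (Metric.ball (intVec (k x)) (Real.sqrt ν)) := fun x =>
    Metric.isOpen_ball.measurableSet
  have hqi : ∀ x, Integrable
      ((Metric.ball (intVec (k x)) (Real.sqrt ν)).indicator fun _ => G) := fun x =>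
    (integrable_indicator_iff (hball x)).2 (integrableOn_const measure_ball_lt_top.ne)
  have hmin : ∀ x, lyapunov ψ U ν x ≤ R * ν →
      ∀ y ∈ Metric.ball (intVec (k x)) (Real.sqrt ν), G ≤ markovKernel F ψ ν n y x := by
    intro x hx y hy
    have hxR := (hVup x).trans hx
    have h1 := le_conjKernel_of_mem_ball hF hψ hν hM0 hM hc (hk x) hxR hy
    have h2 : Z x ≤ Q * D * (Real.exp (R / 2) + 1) := by
      rw [hZe]
      exact integral_conjKernel_mul_le hF hψ hν hQD ht hδ hsmall hxR (hKp x) hupp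
    calc G ≤ Real.exp (-(3 / 2 + M + R / c) / 2) / (D ^ 2 * (Real.exp (R / 2) + 1)) *
            (4 * Real.pi * ν) ^ (-(d : ℝ) / 2) := by rw [hG]; gcongr
      _ = (4 * Real.pi * ν) ^ (-(d : ℝ) / 2) * Real.exp (-(3 / 2 + M + R / c) / 2) * (Q / D) /
            (Q * D * (Real.exp (R / 2) + 1)) := by field_simp
      _ ≤ _ := div_le_div₀ (mul_nonneg (conjKernel_pos hν y x).le (hp0 y))
            (mul_le_mul h1 (hlow y) (by positivity) (conjKernel_pos hν y x).le) (hZ0 x) h2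
  have hβK : α₁ / (C * ν) * (C * ν) = α₁ := by field_simp
  have hβR : α₁ / (C * ν) * (R * ν) = α₁ * R / C := by field_simp
  have hind : ∀ x, (fun y => (Metric.ball (intVec (k x)) (Real.sqrt ν)).indicator
      (fun _ => G) y * u y) =
      (Metric.ball (intVec (k x)) (Real.sqrt ν)).indicator fun y => G * u y := fun x => by
    funext y
    by_cases hy : y ∈ Metric.ball (intVec (k x)) (Real.sqrt ν) <;> simp [hy]
  refine weightedOsc_integral_le (μ := volume) (p := markovKernel F ψ ν n)
    (q := fun y x => (Metric.ball (intVec (k x)) (Real.sqrt ν)).indicator (fun _ => G) y)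
    (γ := (1 + κ / 2)⁻¹) (K := C * ν) (R := R * ν) (a := b * W)
    (I := G * ∫ y in Metric.ball 0 (Real.sqrt ν), u y)
    (by positivity) hα (lyapunov_nonneg (hψ.nonneg hF)) hm0 hmi hm1 hmV hmu ?_ ?_ ?_ ?_ ?_ ?_ ?_
    hγα (by rwa [hβK]) (by rwa [hβK, hβR])
  · intro x
    refine (integral_mul_lyapunov_le hF hψ hν hν1 (by positivity) hψB ht hδ hκ0 hκ hsmall' (hm0 x)
      (hmi x) (hm1 x) (hmV x) (hmA x)).trans ?_
    gcongr
  · intro x _ y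
    exact Set.indicator_nonneg (fun _ _ => by positivity) y
  · intro x hx y
    exact Set.indicator_le' (hmin x hx) (fun y _ => hm0 x y) y
  · exact fun x _ => hqi x
  · exact fun x _ => (hqi x).mul_bdd hu.aestronglyMeasurable (Filter.Eventually.of_forall hL)
  · intro x _
    rw [integral_indicator_const _ (hball x), smul_eq_mul, hG, hW,
      ← rpow_mul_volume_ball_sqrt hν (intVec (k x))]
    ring
  · intro x _
    rw [hind, integral_indicator (hball x), integral_const_mul, setIntegral_ball_intVec huper]

end KickedHJ

theorem mainTheorem7 {d : ℕ} (F : EuclideanSpace ℝ (Fin d) → ℝ) (hF : KickedHJ.IsKickPotential F)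
    (ψ : EuclideanSpace ℝ (Fin d) → ℝ) (hψ : KickedHJ.IsWeakKAM F ψ)
    (U : Set (EuclideanSpace ℝ (Fin d))) (hU : IsOpen U) (hUper : KickedHJ.IsPeriodicSet U)
    (hUD : KickedHJ.dMinus F ψ ⊆ U) (D : ℝ) (hD : 1 < D) :
    ∃ C α α₁ ν₁ : ℝ, 1 < C ∧ α ∈ Set.Ioo (0 : ℝ) 1 ∧ α₁ ∈ Set.Ioo (0 : ℝ) 1 ∧ 0 < ν₁ ∧
      ∀ (ν₀ : ℝ) (N : ℝ → ℕ) (Q : ℕ → ℝ), 0 < ν₀ → (∀ n, 0 < Q n) →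
        (∀ ν ∈ Set.Ioo 0 ν₀, ∀ n ≤ N ν,
          D⁻¹ ^ 3 ≤ Q n / Q (n + 1) ∧ Q n / Q (n + 1) ≤ D ^ 3) →
        (∀ ν ∈ Set.Ioo 0 ν₀, ∀ n ≤ N ν, ∀ x,
          D⁻¹ ≤ KickedHJ.partitionFun F ψ ν n x / Q n ∧
            KickedHJ.partitionFun F ψ ν n x / Q n ≤ D * KickedHJ.chi U ν x) →
        ∀ ν, 0 < ν → ν < ν₀ → ν < ν₁ → ∀ n ≤ N ν,
          ∀ u : EuclideanSpace ℝ (Fin d) → ℝ, AEMeasurable u → (∃ B : ℝ, ∀ x, |u x| ≤ B) →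
            KickedHJ.IsPeriodic u →
            KickedHJ.weightedOsc (α₁ / (C * ν)) (KickedHJ.lyapunov ψ U ν)
                (KickedHJ.markovOp F ψ ν n u) ≤
              ENNReal.ofReal α *
                KickedHJ.weightedOsc (α₁ / (C * ν)) (KickedHJ.lyapunov ψ U ν) u := by
  obtain ⟨M, hM0, hM⟩ := hF.exists_second_difference_le
  obtain ⟨c, hc, hcψ⟩ := hψ.exists_quadratic_le hF
  obtain ⟨κ, hκ0, hκ⟩ := hψ.exists_mul_le_potential hF
  obtain ⟨δ, t, hδ0, ht, hδ⟩ := hψ.exists_defect_ge_of_notMem hF hU hUper hUD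
  obtain ⟨B, hB0, hB⟩ := hψ.periodic.exists_norm_le hψ.continuous
  have hψB : ∀ y, ψ y ≤ B := fun y => (le_abs_self _).trans (hB y)
  obtain ⟨ν₂, hν₂, hs₂⟩ := KickedHJ.exists_forall_rpow_mul_exp_le ((d : ℝ) / 2)
    ((2 * t) ^ (-(d : ℝ) / 2)) (half_pos hδ0)
  -- The exponent pays for three factors `ν^(-d/2)` and for one further `ν⁻¹`, as the error must be
  -- at most `ν`.
  obtain ⟨ν₃, hν₃, hs₃⟩ := KickedHJ.exists_forall_rpow_mul_exp_le (3 * ((d : ℝ) / 2) + 1)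
    (B * (2 * t) ^ (-(d : ℝ) / 2)) (half_pos hδ0)
  have hD0 : 0 < D := one_pos.trans hD
  set γ := (1 + κ / 2)⁻¹ with hγ
  have hγ0 : 0 < γ := by positivity
  have hγ1 : γ < 1 := inv_lt_one_of_one_lt₀ (by linarith)
  set A := D ^ 2 / (2 * (2 + M)) ^ (-(d : ℝ) / 2) * (4 / κ + 1) with hA
  have hA0 : 0 < A := by positivity
  -- With `K = (A + 1)ν`, the level `Rν` equals `4K / (1 - γ)`, beyond the threshold `2K / (1 - γ)`
  -- needed for the drift to win.
  set R := 4 * (A + 1) / (1 - γ) with hR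
  set b₀ := Real.exp (-(3 / 2 + M + R / c) / 2) / (D ^ 2 * (Real.exp (R / 2) + 1)) with hb₀
  have hb₀0 : 0 < b₀ := by positivity
  set W := (4 * Real.pi) ^ (-(d : ℝ) / 2) *
      volume.real (Metric.ball (0 : EuclideanSpace ℝ (Fin d)) 1) with hW
  have hW0 : 0 < W := by
    have : 0 < volume.real (Metric.ball (0 : EuclideanSpace ℝ (Fin d)) 1) :=
      ENNReal.toReal_pos (Metric.measure_ball_pos _ _ one_pos).ne' measure_ball_lt_top.ne
    positivity
  -- Shrinking `b₀` in this way forces the minorization mass `b * W` below `1`.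
  set b := b₀ / (1 + b₀ * W) with hb
  have hb0 : 0 < b := by positivity
  have hbb : b ≤ b₀ := div_le_self hb₀0.le (by nlinarith [mul_pos hb₀0 hW0])
  have ha1 : b * W < 1 := by
    rw [hb, div_mul_eq_mul_div, div_lt_one (by positivity)]
    linarith
  have ha0 : 0 < b * W := by positivity
  -- Half of the minorized mass is spent on the drift error `βK = α₁`, leaving the rate `1 - α₁` at
  -- low points.
  set α₁ := b * W / 2 with hα₁
  have hα₁0 : 0 < α₁ := by positivity
  have hr : α₁ * R / (A + 1) = 4 * α₁ / (1 - γ) := by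
    rw [hR]; field_simp
  set r := 4 * α₁ / (1 - γ) with hr'
  have hr0 : 0 < r := div_pos (by positivity) (sub_pos.2 hγ1)
  have hα₁r : α₁ = r * (1 - γ) / 4 := by
    rw [hr', div_mul_cancel₀ _ (sub_pos.2 hγ1).ne']; ring
  set α₂ := (2 + 2 * α₁ + γ * r) / (2 + r) with hα₂
  have hα₂1 : α₂ < 1 := by
    rw [hα₂, div_lt_one (by positivity), hα₁r]
    nlinarith
  refine ⟨A + 1, max γ (max (1 - α₁) α₂), α₁, min 1 (min ν₂ ν₃), by linarith,
    ⟨lt_max_of_lt_left hγ0, max_lt hγ1 (max_lt (by linarith) hα₂1)⟩,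
    ⟨hα₁0, by linarith⟩, by positivity, ?_⟩
  intro ν₀ N Q _ hQ _ hpQ ν hν hνν₀ hνν₁ n hn u hu hub huper
  have hν1 : ν ≤ 1 := (hνν₁.trans_le (min_le_left _ _)).le
  have h2 := hs₂ ν hν (hνν₁.trans_le ((min_le_right _ _).trans (min_le_left _ _)))
  have h3 := hs₃ ν hν (hνν₁.trans_le ((min_le_right _ _).trans (min_le_right _ _)))
  have he : -(δ / 2) / ν = -δ / (2 * ν) := by field_simp
  have hpow : ν ^ (-(3 * ((d : ℝ) / 2) + 1)) = (ν ^ (-(d : ℝ) / 2)) ^ 3 * ν⁻¹ := by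
    rw [← Real.rpow_natCast, ← Real.rpow_mul hν.le, ← Real.rpow_neg_one ν, ← Real.rpow_add hν]
    congr 1
    push_cast
    ring
  rw [he, ← neg_div] at h2
  rw [he, hpow] at h3
  refine KickedHJ.weightedOsc_markovOp_le hF hψ hU hν hν1 hM0 hM hc hcψ hψB hκ0 hκ ht hδ
    (by linarith) ?_ hD0 (hQ n) (fun y => ?_) (fun y => ?_) (by linarith) (le_add_of_nonneg_right
    zero_le_one) hb0 hbb hα₁0 (lt_max_of_lt_left hγ0) (le_max_left _ _) ?_ ?_ hu hub huper
  · have h4 := mul_le_mul_of_nonneg_right h3 hν.le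
    rw [one_mul] at h4
    refine le_trans (le_of_eq ?_) h4
    field_simp
  · have h4 := (hpQ ν ⟨hν, hνν₀⟩ n hn y).1
    rw [le_div_iff₀ (hQ n)] at h4
    rwa [div_eq_inv_mul]
  · have h4 := (hpQ ν ⟨hν, hνν₀⟩ n hn y).2
    rw [div_le_iff₀ (hQ n)] at h4
    linarith
  · refine le_trans (le_of_eq ?_) ((le_max_left _ _).trans (le_max_right _ _))
    rw [← hW, hα₁]
    ring
  · rw [hr, ← div_le_iff₀ (by positivity)]
    exact (le_max_right _ _).trans (le_max_right _ _)
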